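/- Let $n\ge 1$, $\alpha\ge 0$, $s\ge 0$ and $p,q\in(0,\infty]$. For a Schwartz function $\Lambda_0$ on $\mathbb R^n\times\mathbb R^n$ let $\Lambda(t,\cdot,\cdot)=e^{it(\Delta_x+\Delta_y)/2}\Lambda_0$ be the solution of the free Schrödinger equation with initial value $\Lambda_0$, that is, $\widehat{\Lambda}(t,\xi,\eta)=e^{-it(|\xi|^2+|\eta|^2)/2}\,\widehat{\Lambda_0}(\xi,\eta)$ for $t\in\mathbb R$, where $\widehat{\ }$ is the Fourier transform in the space variables with kernel $e^{-i(x\cdot\xi+y\cdot\eta)}$. Let $|\nabla|_x^\alpha\Lambda(t,x,x)$ denote the Fourier multiplier with symbol $|\xi|^\alpha$ applied to the function $x\mapsto\Lambda(t,x,x)$ on $\mathbb R^n$. Suppose that there is a constant $C<\infty$ such that, for all Schwartz functions $\Lambda_0$, $$\big\|\,|\nabla|_x^\alpha\Lambda(t,x,x)\big\|_{L^p(dt)L^q(dx)}\le C\,\|\Lambda_0\|_{H^s(dx\,dy)},$$ where the left-hand side is the $L^p$ norm over $t\in\mathbb R$ of the $L^q$ norm over $x\in\mathbb R^n$, and $\|\Lambda_0\|_{H^s(dx\,dy)}=\|(1+|\xi|^2+|\eta|^2)^{s/2}\,\widehat{\Lambda_0}\|_{L^2(d\xi\,d\eta)}$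 up to a constant factor. Then $p\ge 2$ and $q\ge 2$. -/

import Mathlib

open MeasureTheory FourierTransform
open scoped SchwartzMap ENNReal NNReal

noncomputable section

namespace Collapsing

/-- `ℝⁿ` with its Euclidean norm. -/
abbrev Space (n : ℕ) : Type := EuclideanSpace ℝ (Fin n)

/-- `ℝⁿ × ℝⁿ` with its Euclidean norm `|(x, y)|² = |x|² + |y|²`. -/
abbrev Space2 (n : ℕ) : Type := WithLp 2 (Space n × Space n)

/-- The free evolution `Λ(t) = e^{it(Δ_x + Δ_y)/2} Λ₀`: the Fourier multiplier with symbol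
`exp(-it(|2πξ|² + |2πη|²)/2)`. The Fourier transform is normalised by
`𝓕 f ζ = ∫ exp(-2πi ⟨z, ζ⟩) f z dz`, so that `Δ_x` has symbol `-|2πξ|²`. -/
def evolution {n : ℕ} (Λ₀ : Space2 n → ℂ) (t : ℝ) : Space2 n → ℂ :=
  𝓕⁻ fun ζ : Space2 n ↦
    Complex.exp (-(Complex.I * t *
      (((2 * Real.pi * ‖ζ.fst‖) ^ 2 + (2 * Real.pi * ‖ζ.snd‖) ^ 2 : ℝ) : ℂ) / 2)) * 𝓕 Λ₀ ζ

/-- The restriction `x ↦ F(x, x)` to the diagonal. -/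
def diagonal {n : ℕ} (F : Space2 n → ℂ) : Space n → ℂ :=
  fun x ↦ F (WithLp.toLp 2 (x, x))

/-- `|∇|^α`: the Fourier multiplier with symbol `|2πξ|^α`. -/
def fracDeriv {n : ℕ} (α : ℝ) (g : Space n → ℂ) : Space n → ℂ :=
  𝓕⁻ fun ξ : Space n ↦ (((2 * Real.pi * ‖ξ‖) ^ α : ℝ) : ℂ) * 𝓕 g ξ

/-- The mixed norm `‖u‖_{L^p(dt) L^q(dx)}` over `ℝ × ℝⁿ`, with values in `[0, ∞]`. -/
def mixedNorm {n : ℕ} (p q : ℝ≥0∞) (u : ℝ → Space n → ℂ) : ℝ≥0∞ :=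
  eLpNorm (fun t ↦ eLpNorm (u t) q volume) p volume

/-- The Sobolev norm `‖f‖_{H^s(dx dy)} = ‖(1 + |2πζ|²)^{s/2} 𝓕 f‖_{L²}`, with values in
`[0, ∞]`. -/
def sobolevNorm {n : ℕ} (s : ℝ) (f : Space2 n → ℂ) : ℝ≥0∞ :=
  eLpNorm (fun ζ : Space2 n ↦
    (((1 + (2 * Real.pi * ‖ζ‖) ^ 2) ^ (s / 2) : ℝ) : ℂ) * 𝓕 f ζ) 2 volume

end Collapsing

end

/-! The estimate is invariant under translations in time and along the spatial diagonal, so a single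
solution can be repeated `N` times. The datum with Fourier transform `exp (-‖ζ‖²)` gives a
continuous `W = profile α`, nonzero at the origin. Superpose its translates by `k • v`, `k < N`,
with signs. All translates have the same modulus in frequency, so the squared Sobolev norm averages
over the signs to exactly `N` times that of one datum (`sum_sq_sobolevNorm_signed_sum`). The left
side, averaged in `L^r` over disjoint unit balls, is at least a multiple of `N`
(`card_mul_lintegral_le_sum_signed_translates`).

Take `r = min p q` and suppose `r < 2`. Translating in the variable carrying the exponent `r` keeps
the other variable in a unit ball, where Hölder lowers its exponent to `r`. The estimate then forces
`N ≲ N ^ (r / 2)` for all `N`, which is absurd. -/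

noncomputable section

namespace Collapsing

/-! ### Exponentials with Gaussian decay are Schwartz functions -/

section Schwartz

variable {V : Type*} [NormedAddCommGroup V] [InnerProductSpace ℝ V]

theorem norm_iteratedFDeriv_cexp (i : ℕ) (w : ℂ) :
    ‖iteratedFDeriv ℝ i Complex.exp w‖ =
      Real.exp w.re * ‖iteratedFDeriv ℝ i Complex.exp 0‖ := by
  have h : (fun z : ℂ ↦ Complex.exp (w + z)) = Complex.exp w • Complex.exp := by
    ext z
    simp [Complex.exp_add]
  have h1 := iteratedFDeriv_comp_add_left (𝕜 := ℝ) (f := Complex.exp) i w 0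
  rw [h, iteratedFDeriv_const_smul_apply
    (Complex.contDiff_exp (𝕜 := ℝ) (n := i)).contDiffAt, add_zero] at h1
  rw [← h1, norm_smul, Complex.norm_exp]

/-- The Schwartz function `exp ∘ f`, for `f` of temperate growth with
`Re f ≤ -c ‖x‖²`. -/
theorem exists_schwartz_cexp {f : V → ℂ} (hf : f.HasTemperateGrowth) {c : ℝ} (hc : 0 < c)
    (hre : ∀ x, (f x).re ≤ -c * ‖x‖ ^ 2) :
    ∃ g : 𝓢(V, ℂ), ∀ x, g x = Complex.exp (f x) := by
  refine ⟨⟨fun x ↦ Complex.exp (f x), Complex.contDiff_exp.comp hf.1, fun k m ↦ ?_⟩,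
    fun x ↦ rfl⟩
  obtain ⟨K, C, hC0, hC⟩ := hf.norm_iteratedFDeriv_le_uniform m
  set A : ℝ := ∑ i ∈ Finset.range (m + 1), ‖iteratedFDeriv ℝ i Complex.exp 0‖ with hA
  have hA0 : 0 ≤ A := Finset.sum_nonneg fun _ _ ↦ norm_nonneg _
  have hbd : ∃ B : ℝ, ∀ r : ℝ, 0 ≤ r → (1 + r) ^ (k + K * m) * Real.exp (-c * r ^ 2) ≤ B := by
    set N := k + K * m
    have h1 : Filter.Tendsto (fun r : ℝ ↦ r ^ (N : ℝ) * Real.exp (-c * r ^ 2))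
        Filter.atTop (nhds 0) := by
      have := rpow_mul_exp_neg_mul_sq_isLittleO_exp_neg hc (N : ℝ)
      refine this.trans_tendsto ?_
      refine Real.tendsto_exp_atBot.comp ?_
      exact Filter.Tendsto.const_mul_atTop_of_neg (by norm_num) Filter.tendsto_id
    have h2 : ∀ᶠ r : ℝ in Filter.atTop, r ^ (N : ℝ) * Real.exp (-c * r ^ 2) ≤ 1 :=
      h1.eventually (ge_mem_nhds one_pos)
    obtain ⟨R, hR⟩ := Filter.eventually_atTop.1 (h2.and (Filter.eventually_ge_atTop 1))
    have hR1 : 1 ≤ R := (hR R le_rfl).2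
    refine ⟨2 ^ N * (R ^ N + 1), fun r hr ↦ ?_⟩
    have hm : (1 + r) ^ N ≤ 2 ^ N * (max 1 r) ^ N := by
      rw [← mul_pow]
      refine pow_le_pow_left₀ (by positivity) ?_ _
      linarith [le_max_left 1 r, le_max_right 1 r]
    refine (mul_le_mul_of_nonneg_right hm (Real.exp_pos _).le).trans ?_
    rw [mul_assoc]
    refine mul_le_mul_of_nonneg_left ?_ (by positivity)
    by_cases h : R ≤ r
    · have h3 := (hR r h).1
      rw [Real.rpow_natCast] at h3
      rw [max_eq_right (hR1.trans h)]
      exact h3.trans (by linarith [pow_pos (one_pos.trans_le hR1) N])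
    · have h3 : Real.exp (-c * r ^ 2) ≤ 1 := Real.exp_le_one_iff.2 (by nlinarith [sq_nonneg r])
      have h4 : (max 1 r) ^ N ≤ R ^ N :=
        pow_le_pow_left₀ (by positivity) (max_le hR1 (not_le.1 h).le) _
      calc _ ≤ R ^ N * 1 := mul_le_mul h4 h3 (Real.exp_pos _).le (by positivity)
        _ ≤ _ := by linarith
  obtain ⟨B, hB⟩ := hbd
  refine ⟨m.factorial * A * (max 1 C) ^ m * B, fun x ↦ ?_⟩
  -- The composition bound asks for `‖D^i f‖ ≤ D ^ i`; since `D ≥ 1`, the bound `‖D^i f‖ ≤ D`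
  -- suffices for `i ≥ 1`. Derivatives of `exp` at `f x` cost `exp (Re f x)`, whose Gaussian decay
  -- absorbs the polynomial factors.
  have key := norm_iteratedFDeriv_comp_le (𝕜 := ℝ) (g := Complex.exp) (f := f) (n := m)
    (N := m) Complex.contDiff_exp (hf.1.of_le (by exact_mod_cast le_top)) le_rfl x
    (C := Real.exp (f x).re * A) (D := max 1 C * (1 + ‖x‖) ^ K) ?_ ?_
  · have h1 : Real.exp (f x).re ≤ Real.exp (-c * ‖x‖ ^ 2) := Real.exp_le_exp.2 (hre x)
    have h2 : ‖x‖ ^ k ≤ (1 + ‖x‖) ^ k :=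
      pow_le_pow_left₀ (norm_nonneg _) (by linarith) _
    calc ‖x‖ ^ k * ‖iteratedFDeriv ℝ m (Complex.exp ∘ f) x‖
        ≤ (1 + ‖x‖) ^ k * (m.factorial * (Real.exp (-c * ‖x‖ ^ 2) * A) *
            (max 1 C * (1 + ‖x‖) ^ K) ^ m) := by
          refine mul_le_mul h2 (key.trans ?_) (norm_nonneg _) (by positivity)
          gcongr
      _ = m.factorial * A * (max 1 C) ^ m *
            ((1 + ‖x‖) ^ (k + K * m) * Real.exp (-c * ‖x‖ ^ 2)) := by
          rw [mul_pow, ← pow_mul, pow_add]; ring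
      _ ≤ _ := mul_le_mul_of_nonneg_left (hB _ (norm_nonneg _)) (by positivity)
  · intro i hi
    rw [norm_iteratedFDeriv_cexp]
    refine mul_le_mul_of_nonneg_left ?_ (Real.exp_pos _).le
    exact Finset.single_le_sum (f := fun i ↦ ‖iteratedFDeriv ℝ i Complex.exp 0‖)
      (fun _ _ ↦ norm_nonneg _) (Finset.mem_range.2 (by omega))
  · intro i hi1 hi
    have h1 : 1 ≤ max 1 C * (1 + ‖x‖) ^ K :=
      one_le_mul_of_one_le_of_one_le (le_max_left _ _)
        (one_le_pow₀ (by linarith [norm_nonneg x]))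
    refine (hC i hi x).trans (le_trans ?_ (le_self_pow₀ h1 (by omega)))
    exact mul_le_mul_of_nonneg_right (le_max_right _ _) (by positivity)

theorem hasTemperateGrowth_gaussian_exponent (b : ℂ) (a : V) :
    (fun x : V ↦ -b * (‖x‖ : ℂ) ^ 2 +
      2 * Real.pi * Complex.I * (inner ℝ a x : ℝ)).HasTemperateGrowth := by
  have h1 : (fun x : V ↦ ((‖x‖ ^ 2 : ℝ) : ℂ)).HasTemperateGrowth :=
    Function.HasTemperateGrowth.comp Function.Complex.hasTemperateGrowth_ofReal (Function.hasTemperateGrowth_norm_sq (H := V))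
  have h2 : (fun x : V ↦ ((inner ℝ a x : ℝ) : ℂ)).HasTemperateGrowth :=
    Function.HasTemperateGrowth.comp Function.Complex.hasTemperateGrowth_ofReal (Function.hasTemperateGrowth_inner_right a)
  have h3 := ((Function.HasTemperateGrowth.const (-b)).mul h1).add
    ((Function.HasTemperateGrowth.const (2 * Real.pi * Complex.I)).mul h2)
  refine cast (congrArg _ ?_) h3
  ext x
  simp

theorem exists_gaussian (b : ℂ) (hb : 0 < b.re) (a : V) :
    ∃ g : 𝓢(V, ℂ), ∀ x, g x = Complex.exp (-b * (‖x‖ : ℂ) ^ 2 +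
      2 * Real.pi * Complex.I * (inner ℝ a x : ℝ)) := by
  refine exists_schwartz_cexp (hasTemperateGrowth_gaussian_exponent b a) hb fun x ↦ le_of_eq ?_
  rw [← Complex.ofReal_pow]
  simp [Complex.mul_re, -Complex.ofReal_pow]

end Schwartz

/-! ### Modulated Gaussians and their Fourier transforms -/

section Gaussian

variable {V : Type*} [NormedAddCommGroup V] [InnerProductSpace ℝ V]

/-- The modulated complex Gaussian `x ↦ exp (-b ‖x‖² + 2πi ⟪a, x⟫)`. -/
def gaussian (b : ℂ) (a x : V) : ℂ :=
  Complex.exp (-b * (‖x‖ : ℂ) ^ 2 + 2 * Real.pi * Complex.I * (inner ℝ a x : ℝ))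

theorem exists_schwartz_eq_gaussian {b : ℂ} (hb : 0 < b.re) (a : V) :
    ∃ g : 𝓢(V, ℂ), ⇑g = gaussian b a :=
  (exists_gaussian b hb a).imp fun _ h ↦ funext h

theorem continuous_gaussian (b : ℂ) (a : V) : Continuous (gaussian b a) := by
  unfold gaussian
  fun_prop

theorem norm_gaussian (b : ℂ) (a x : V) : ‖gaussian b a x‖ = Real.exp (-b.re * ‖x‖ ^ 2) := by
  rw [gaussian, Complex.norm_exp, ← Complex.ofReal_pow]
  simp [Complex.mul_re, -Complex.ofReal_pow]

theorem gaussian_mul_cexp (b c : ℂ) (a x : V) :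
    gaussian b a x * Complex.exp (-c * (‖x‖ : ℂ) ^ 2) = gaussian (b + c) a x := by
  rw [gaussian, gaussian, ← Complex.exp_add]
  congr 1
  ring

theorem cexp_mul_gaussian (b : ℂ) (a x w : V) :
    Complex.exp (((2 * Real.pi * inner ℝ x w : ℝ) : ℂ) * Complex.I) * gaussian b a x =
      Complex.exp (((2 * Real.pi * inner ℝ x (w + a) : ℝ) : ℂ) * Complex.I) *
        gaussian b 0 x := by
  rw [gaussian, gaussian, ← Complex.exp_add, ← Complex.exp_add, inner_add_right,
    real_inner_comm x a, inner_zero_left]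
  congr 1
  push_cast
  ring

variable [FiniteDimensional ℝ V] [MeasurableSpace V] [BorelSpace V]

theorem integrable_gaussian {b : ℂ} (hb : 0 < b.re) (a : V) : Integrable (gaussian b a) := by
  obtain ⟨g, hg⟩ := exists_schwartz_eq_gaussian hb a
  exact hg ▸ g.integrable

theorem fourierInv_gaussian {b : ℂ} (hb : 0 < b.re) (a w : V) :
    𝓕⁻ (gaussian b a) w = (Real.pi / b) ^ (Module.finrank ℝ V / 2 : ℂ) *
      Complex.exp (-Real.pi ^ 2 * (‖a + w‖ : ℂ) ^ 2 / b) := by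
  have h := fourier_gaussian_innerProductSpace' hb a (-w)
  rw [sub_neg_eq_add] at h
  rw [Real.fourierInv_eq_fourier_neg, ← h]
  rfl

/-- Defined on the frequency side, so that the transform comes from Fourier inversion. It serves
both for the initial datum and for its evolution on the diagonal. -/
theorem exists_schwartz_gaussian_sum {ι : Type*} (s : Finset ι) (c : ι → ℂ) (b : ι → ℂ)
    (hb : ∀ k, 0 < (b k).re) (a : ι → V) :
    ∃ g : 𝓢(V, ℂ), (∀ x, g x = ∑ k ∈ s, c k * 𝓕⁻ (gaussian (b k) (a k)) x) ∧
      ∀ ξ, 𝓕 (⇑g) ξ = ∑ k ∈ s, c k * gaussian (b k) (a k) ξ := by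
  choose h hh using fun k ↦ exists_schwartz_eq_gaussian (hb k) (a k)
  refine ⟨∑ k ∈ s, c k • 𝓕⁻ (h k), fun x ↦ ?_, fun ξ ↦ ?_⟩
  · simp only [sum_apply, smul_apply, smul_eq_mul,
      SchwartzMap.fourierInv_coe, hh]
  · have h1 : 𝓕 (∑ k ∈ s, c k • 𝓕⁻ (h k)) = ∑ k ∈ s, c k • h k := by
      rw [← FourierTransform.fourierCLM_apply (R := ℂ), map_sum]
      refine Finset.sum_congr rfl fun k _ ↦ ?_
      rw [map_smul, FourierTransform.fourierCLM_apply, FourierTransform.fourier_fourierInv_eq]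
    rw [← SchwartzMap.fourier_coe, h1]
    simp only [sum_apply, smul_apply, smul_eq_mul, hh]

theorem fourierInv_sum_mul {ι : Type*} (s : Finset ι) (c : ι → ℂ) (f : ι → V → ℂ)
    (hf : ∀ k, Integrable (f k)) (x : V) :
    𝓕⁻ (fun ξ ↦ ∑ k ∈ s, c k * f k ξ) x = ∑ k ∈ s, c k * 𝓕⁻ (f k) x := by
  simp only [Real.fourierInv_eq, Finset.smul_sum]
  rw [integral_finsetSum]
  · refine Finset.sum_congr rfl fun k _ ↦ ?_
    rw [← integral_const_mul]
    congr 1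
    ext v
    simp only [Circle.smul_def, smul_eq_mul]
    ring
  · intro k _
    have := (Real.fourierIntegral_convergent_iff (μ := volume) (f := fun v ↦ c k * f k v)
      (-x)).2 ((hf k).const_mul _)
    simpa using this

theorem integrable_rpow_mul_exp_neg {α c : ℝ} (hα : 0 ≤ α) (hc : 0 < c) :
    Integrable fun ξ : V ↦ (2 * Real.pi * ‖ξ‖) ^ α * Real.exp (-c * ‖ξ‖ ^ 2) := by
  obtain ⟨g, hg⟩ := exists_schwartz_eq_gaussian (b := (c : ℂ)) (by simpa) (0 : V)
  have hn : ∀ x, ‖g x‖ = Real.exp (-c * ‖x‖ ^ 2) := fun x ↦ by simp [hg, norm_gaussian]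
  have h1 := ((g.integrable.norm (μ := volume)).add
    (g.integrable_pow_mul volume ⌈α⌉₊)).const_mul ((2 * Real.pi) ^ α)
  refine h1.mono' ?_ (.of_forall fun ξ ↦ ?_)
  · refine Continuous.aestronglyMeasurable ?_
    refine Continuous.mul (Continuous.rpow_const (by fun_prop) fun _ ↦ .inr hα) (by fun_prop)
  · have hξ := norm_nonneg ξ
    have h2 : ‖ξ‖ ^ α ≤ 1 + ‖ξ‖ ^ ⌈α⌉₊ := by
      rcases le_total ‖ξ‖ 1 with h | h
      · exact (Real.rpow_le_one hξ h hα).trans (by linarith [pow_nonneg hξ ⌈α⌉₊])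
      · have := Real.rpow_le_rpow_of_exponent_le h (Nat.le_ceil α)
        rw [Real.rpow_natCast] at this
        linarith
    rw [Real.norm_of_nonneg (by positivity), Real.mul_rpow (by positivity) hξ]
    simp only [Pi.add_apply, hn]
    rw [mul_assoc]
    refine mul_le_mul_of_nonneg_left ?_ (by positivity)
    calc _ ≤ (1 + ‖ξ‖ ^ ⌈α⌉₊) * Real.exp (-c * ‖ξ‖ ^ 2) :=
          mul_le_mul_of_nonneg_right h2 (Real.exp_pos _).le
      _ = _ := by ring

theorem integrable_rpow_mul_gaussian {α : ℝ} (hα : 0 ≤ α) {b : ℂ} (hb : 0 < b.re) (a : V) :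
    Integrable fun ξ : V ↦ (((2 * Real.pi * ‖ξ‖) ^ α : ℝ) : ℂ) * gaussian b a ξ := by
  refine (integrable_rpow_mul_exp_neg (V := V) hα hb).mono' ?_ (.of_forall fun ξ ↦ ?_)
  · refine Continuous.aestronglyMeasurable (Continuous.mul ?_ (continuous_gaussian b a))
    exact Complex.continuous_ofReal.comp
      (Continuous.rpow_const (by fun_prop) fun _ ↦ .inr hα)
  · rw [norm_mul, norm_gaussian, Complex.norm_real, Real.norm_of_nonneg (by positivity)]

theorem fourierInv_mul_gaussian_translate (m : V → ℂ) (b : ℂ) (a x : V) :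
    𝓕⁻ (fun ξ ↦ m ξ * gaussian b a ξ) x = 𝓕⁻ (fun ξ ↦ m ξ * gaussian b 0 ξ) (x + a) := by
  rw [Real.fourierInv_eq', Real.fourierInv_eq']
  congr 1
  ext ξ
  rw [smul_eq_mul, smul_eq_mul, mul_left_comm, cexp_mul_gaussian, mul_left_comm]

theorem eLpNorm_sobolev_gaussian_ne_top (s : ℝ) :
    eLpNorm (fun ζ : V ↦ (((1 + (2 * Real.pi * ‖ζ‖) ^ 2) ^ (s / 2) : ℝ) : ℂ) *
      gaussian 1 0 ζ) 2 volume ≠ ⊤ := by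
  obtain ⟨g, hg⟩ := exists_schwartz_eq_gaussian (b := 1) (by simp) (0 : V)
  have h1 : (fun ζ : V ↦
      (((1 + (2 * Real.pi * ‖ζ‖) ^ 2) ^ (s / 2) : ℝ) : ℂ)).HasTemperateGrowth := by
    have h2 := (Function.hasTemperateGrowth_one_add_norm_sq_rpow V (s / 2)).comp
      ((2 * Real.pi) • ContinuousLinearMap.id ℝ V).hasTemperateGrowth
    have h3 := Function.HasTemperateGrowth.comp Function.Complex.hasTemperateGrowth_ofReal h2
    refine cast (congrArg _ ?_) h3
    ext x
    simp [norm_smul, abs_of_pos Real.pi_pos]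
  have h2 := (SchwartzMap.smulLeftCLM ℂ (fun ζ : V ↦
    (((1 + (2 * Real.pi * ‖ζ‖) ^ 2) ^ (s / 2) : ℝ) : ℂ)) g).eLpNorm_lt_top 2 volume
  refine ne_of_lt (lt_of_eq_of_lt ?_ h2)
  congr 1
  ext ζ
  rw [SchwartzMap.smulLeftCLM_apply_apply h1, hg, smul_eq_mul]

end Gaussian

/-! ### The evolution of Gaussians and its restriction to the diagonal -/

variable {n : ℕ}

/-- The complex width of the Gaussian `exp (-‖ζ‖²)` after time `t`. -/
def width (t : ℝ) : ℂ := 1 + ((2 * Real.pi ^ 2 * t : ℝ) : ℂ) * Complex.I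

/-- Time enters only the phase, so the modulus in frequency is the same at all times. -/
theorem width_re (t : ℝ) : (width t).re = 1 := by
  simp [width, -Complex.ofReal_mul]

theorem width_re_pos (t : ℝ) : 0 < (width t).re := by
  rw [width_re]
  norm_num

theorem width_half_re (t : ℝ) : (width t / 2).re = 1 / 2 := by
  rw [show (2 : ℂ) = ((2 : ℝ) : ℂ) by norm_num, Complex.div_ofReal_re, width_re]

theorem width_half_re_pos (t : ℝ) : 0 < (width t / 2).re := by
  rw [width_half_re]
  norm_num

theorem continuous_width : Continuous width := by
  unfold width
  fun_prop

theorem pi_div_mem_slitPlane {b : ℂ} (hb : 0 < b.re) : (Real.pi : ℂ) / b ∈ Complex.slitPlane := by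
  left
  have hb0 : b ≠ 0 := by
    rintro rfl
    simp at hb
  rw [div_eq_mul_inv, Complex.re_ofReal_mul, Complex.inv_re]
  have := Complex.normSq_pos.2 hb0
  have := Real.pi_pos
  positivity

/-- The point `(a, a)` of the diagonal. -/
def diagonalPoint (a : Space n) : Space2 n := WithLp.toLp 2 (a, a)

theorem norm_diagonalPoint_add (a x : Space n) :
    ‖diagonalPoint a + diagonalPoint x‖ ^ 2 = 2 * ‖a + x‖ ^ 2 := by
  rw [WithLp.prod_norm_sq_eq_of_L2, two_mul]
  rfl

/-- The ratio of a Gaussian on `ℝⁿ × ℝⁿ`, restricted to the diagonal, to the corresponding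
Gaussian on `ℝⁿ`. -/
def diagonalFactor (n : ℕ) (b : ℂ) : ℂ :=
  (Real.pi / b) ^ (Module.finrank ℝ (Space2 n) / 2 : ℂ) /
    (Real.pi / (b / 2)) ^ (Module.finrank ℝ (Space n) / 2 : ℂ)

/-- On the diagonal the squared norm doubles, which amounts to halving `b`. The restriction is thus
again a Gaussian with explicit Fourier transform. -/
theorem fourierInv_gaussian_diagonalPoint {b : ℂ} (hb : 0 < b.re) (a x : Space n) :
    𝓕⁻ (gaussian b (diagonalPoint a)) (diagonalPoint x) =
      diagonalFactor n b * 𝓕⁻ (gaussian (b / 2) a) x := by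
  have hb2 : 0 < (b / 2).re := by
    rw [show (2 : ℂ) = ((2 : ℝ) : ℂ) by norm_num, Complex.div_ofReal_re]
    positivity
  have h0 : ((Real.pi : ℂ) / (b / 2)) ^ (Module.finrank ℝ (Space n) / 2 : ℂ) ≠ 0 := by
    rw [Ne, Complex.cpow_eq_zero_iff]
    exact fun h ↦ Complex.slitPlane_ne_zero (pi_div_mem_slitPlane hb2) h.1
  have hb0 : b ≠ 0 := by
    rintro rfl
    simp at hb
  rw [fourierInv_gaussian hb, fourierInv_gaussian hb2, diagonalFactor, ← mul_assoc,
    div_mul_cancel₀ _ h0, ← Complex.ofReal_pow ‖_‖, norm_diagonalPoint_add]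
  congr 2
  push_cast
  field_simp

theorem evolution_eq_of_fourier_eq {ι : Type*} (s : Finset ι) (c : ι → ℂ) (τ : ι → ℝ)
    (a : ι → Space2 n) (Λ : Space2 n → ℂ)
    (hΛ : ∀ ζ, 𝓕 Λ ζ = ∑ k ∈ s, c k * gaussian (width (τ k)) (a k) ζ) (t : ℝ) (z : Space2 n) :
    evolution Λ t z = ∑ k ∈ s, c k * 𝓕⁻ (gaussian (width (t + τ k)) (a k)) z := by
  rw [evolution, ← fourierInv_sum_mul s c (fun k ↦ gaussian (width (t + τ k)) (a k))
    fun k ↦ integrable_gaussian (width_re_pos _) _]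
  refine congrFun (congrArg _ (funext fun ζ ↦ ?_)) z
  rw [hΛ, Finset.mul_sum]
  refine Finset.sum_congr rfl fun k _ ↦ ?_
  have h1 : width (t + τ k) = width (τ k) + (2 * Real.pi ^ 2 * t : ℝ) * Complex.I := by
    simp only [width]
    push_cast
    ring
  have h2 := WithLp.prod_norm_sq_eq_of_L2 ζ
  rw [h1, ← gaussian_mul_cexp, mul_left_comm, mul_comm (Complex.exp _)]
  congr 3
  rw [← Complex.ofReal_pow, h2]
  push_cast
  ring

/-- The function `|∇|^α Λ(t, x, x)` for the solution whose initial value has the Fourier transform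
`exp (-‖ζ‖²)`. -/
def profile (α t : ℝ) (x : Space n) : ℂ :=
  diagonalFactor n (width t) *
    𝓕⁻ (fun ξ : Space n ↦ (((2 * Real.pi * ‖ξ‖) ^ α : ℝ) : ℂ) * gaussian (width t / 2) 0 ξ) x

/-- A time shift is stored in the width, a space shift in the modulation by `(a, a)`; the evolution
and the multiplier respect both. -/
theorem exists_superposition {α : ℝ} (hα : 0 ≤ α) {ι : Type*} (s : Finset ι) (c : ι → ℂ)
    (τ : ι → ℝ) (a : ι → Space n) :
    ∃ Λ : 𝓢(Space2 n, ℂ),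
      (∀ ζ, 𝓕 (⇑Λ) ζ = ∑ k ∈ s, c k * gaussian (width (τ k)) (diagonalPoint (a k)) ζ) ∧
      ∀ t x, fracDeriv α (diagonal (evolution (⇑Λ) t)) x =
        ∑ k ∈ s, c k * profile α (t + τ k) (x + a k) := by
  obtain ⟨Λ, -, hΛ⟩ := exists_schwartz_gaussian_sum s c (fun k ↦ width (τ k))
    (fun k ↦ width_re_pos _) fun k ↦ diagonalPoint (a k)
  refine ⟨Λ, hΛ, fun t x ↦ ?_⟩
  obtain ⟨g, hg, hg'⟩ := exists_schwartz_gaussian_sum s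
    (fun k ↦ c k * diagonalFactor n (width (t + τ k))) (fun k ↦ width (t + τ k) / 2)
    (fun k ↦ width_half_re_pos _) a
  have h1 : diagonal (evolution (⇑Λ) t) = g := by
    ext y
    rw [hg, diagonal, evolution_eq_of_fourier_eq s c τ _ _ hΛ]
    refine Finset.sum_congr rfl fun k _ ↦ ?_
    rw [mul_assoc, ← fourierInv_gaussian_diagonalPoint (width_re_pos _)]
    rfl
  have h2 := fourierInv_sum_mul s (fun k ↦ c k * diagonalFactor n (width (t + τ k)))
    (fun k ξ ↦ (((2 * Real.pi * ‖ξ‖) ^ α : ℝ) : ℂ) * gaussian (width (t + τ k) / 2) (a k) ξ)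
    (fun k ↦ integrable_rpow_mul_gaussian hα (width_half_re_pos _) _) x
  rw [fracDeriv, h1]
  simp only [hg', Finset.mul_sum, profile]
  simp only [fourierInv_mul_gaussian_translate _ _ (a _)] at h2
  simp only [← mul_assoc] at h2 ⊢
  rw [← h2]
  refine congrFun (congrArg _ (funext fun ξ ↦ ?_)) x
  refine Finset.sum_congr rfl fun k _ ↦ ?_
  ring

theorem continuous_profile {α : ℝ} (hα : 0 ≤ α) :
    Continuous fun z : ℝ × Space n ↦ profile α z.1 z.2 := by
  unfold profile diagonalFactor
  have hw : Continuous fun z : ℝ × Space n ↦ width z.1 := continuous_width.comp continuous_fst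
  have hne : ∀ t, width t ≠ 0 := fun t h ↦ by simpa [h] using width_re_pos t
  refine Continuous.mul (Continuous.div ?_ ?_ ?_) ?_
  · refine Continuous.cpow (continuous_const.div hw fun z ↦ hne _) continuous_const fun z ↦ ?_
    exact pi_div_mem_slitPlane (width_re_pos _)
  · refine Continuous.cpow (continuous_const.div (hw.div_const _) fun z ↦ ?_) continuous_const
      fun z ↦ pi_div_mem_slitPlane (width_half_re_pos _)
    exact div_ne_zero (hne _) two_ne_zero
  · intro z
    rw [Ne, Complex.cpow_eq_zero_iff]
    exact fun h ↦ Complex.slitPlane_ne_zero (pi_div_mem_slitPlane (width_half_re_pos _)) h.1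
  · simp only [Real.fourierInv_eq']
    -- One dominating function serves all times because `(width t / 2).re = 1 / 2`.
    refine continuous_of_dominated (bound := fun ξ : Space n ↦
      (2 * Real.pi * ‖ξ‖) ^ α * Real.exp (-(1 / 2) * ‖ξ‖ ^ 2)) ?_ ?_
      (integrable_rpow_mul_exp_neg hα (by norm_num)) ?_
    · intro z
      refine Continuous.aestronglyMeasurable (Continuous.smul (f := fun ξ ↦
        Complex.exp (((2 * Real.pi * inner ℝ ξ z.2 : ℝ) : ℂ) * Complex.I)) (by fun_prop)
        (Continuous.mul ?_ (continuous_gaussian _ _)))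
      exact Complex.continuous_ofReal.comp
        (Continuous.rpow_const (by fun_prop) fun _ ↦ .inr hα)
    · intro z
      refine .of_forall fun ξ ↦ le_of_eq ?_
      rw [norm_smul, Complex.norm_exp_ofReal_mul_I, one_mul, norm_mul, norm_gaussian,
        Complex.norm_real, Real.norm_of_nonneg (by positivity), width_half_re]
    · refine .of_forall fun ξ ↦ ?_
      unfold gaussian
      fun_prop

/-- At time and position zero the phases vanish, leaving the integral of a nonnegative continuous
function that is positive at a unit vector. -/
theorem profile_zero_ne_zero (hn : 1 ≤ n) {α : ℝ} (hα : 0 ≤ α) :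
    profile α 0 (0 : Space n) ≠ 0 := by
  have hcont : Continuous fun ξ : Space n ↦
      (2 * Real.pi * ‖ξ‖) ^ α * Real.exp (-(1 / 2) * ‖ξ‖ ^ 2) :=
    Continuous.mul (Continuous.rpow_const (by fun_prop) fun _ ↦ .inr hα) (by fun_prop)
  refine mul_ne_zero (div_ne_zero ?_ ?_) ?_
  · rw [Ne, Complex.cpow_eq_zero_iff]
    exact fun h ↦ Complex.slitPlane_ne_zero (pi_div_mem_slitPlane (width_re_pos _)) h.1
  · rw [Ne, Complex.cpow_eq_zero_iff]
    exact fun h ↦ Complex.slitPlane_ne_zero (pi_div_mem_slitPlane (width_half_re_pos _)) h.1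
  · have h1 : 𝓕⁻ (fun ξ : Space n ↦ (((2 * Real.pi * ‖ξ‖) ^ α : ℝ) : ℂ) *
        gaussian (width 0 / 2) 0 ξ) 0 = ((∫ ξ : Space n,
          (2 * Real.pi * ‖ξ‖) ^ α * Real.exp (-(1 / 2) * ‖ξ‖ ^ 2) : ℝ) : ℂ) := by
      rw [Real.fourierInv_eq', ← integral_complex_ofReal]
      congr 1
      ext ξ
      simp [gaussian, width]
    rw [h1, Complex.ofReal_ne_zero]
    intro h
    rw [integral_eq_zero_iff_of_nonneg (fun ξ ↦ by positivity)
      (integrable_rpow_mul_exp_neg hα (by norm_num)),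
      Continuous.ae_eq_iff_eq volume hcont continuous_zero] at h
    have h2 := congrFun h (EuclideanSpace.single ⟨0, hn⟩ 1)
    have := Real.pi_pos
    have h3 : (0 : ℝ) < (2 * Real.pi) ^ α * Real.exp (-(1 / 2)) := by positivity
    simp at h2
    norm_num at h3
    simp_all

/-! ### Averages over random signs -/

/-- The sign `±1` attached to a Boolean. -/
def boolSign (b : Bool) : ℂ := if b then 1 else -1

theorem norm_boolSign (b : Bool) : ‖boolSign b‖ = 1 := by
  cases b <;> simp [boolSign]

theorem boolSign_not (b : Bool) : boolSign (!b) = -boolSign b := by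
  cases b <;> simp [boolSign]

/-- Orthogonality of the signs, by the parallelogram law one sign at a time. -/
theorem sum_sq_norm_signed_sum (N : ℕ) (c : Fin N → ℂ) :
    ∑ ε : Fin N → Bool, ‖∑ k, boolSign (ε k) * c k‖ ^ 2 = 2 ^ N * ∑ k, ‖c k‖ ^ 2 := by
  induction N with
  | zero => simp
  | succ N ih =>
    rw [← (Fin.consEquiv fun _ ↦ Bool).sum_comp, Fintype.sum_prod_type, Fintype.sum_bool,
      ← Finset.sum_add_distrib]
    simp only [Fin.consEquiv_apply, Fin.sum_univ_succ, Fin.cons_zero, Fin.cons_succ]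
    have h (z w : ℂ) : ‖boolSign true * z + w‖ ^ 2 + ‖boolSign false * z + w‖ ^ 2 =
        2 * ‖z‖ ^ 2 + 2 * ‖w‖ ^ 2 := by
      have := parallelogram_law_with_norm ℝ w z
      rw [show boolSign true * z + w = w + z by simp [boolSign, add_comm],
        show boolSign false * z + w = w - z by simp [boolSign]; ring]
      linarith
    simp only [h, Finset.sum_add_distrib, ← Finset.mul_sum, ih]
    simp
    ring

theorem sum_sq_enorm_signed_sum (N : ℕ) (c : Fin N → ℂ) :
    ∑ ε : Fin N → Bool, ‖∑ k, boolSign (ε k) * c k‖ₑ ^ 2 = 2 ^ N * ∑ k, ‖c k‖ₑ ^ 2 := by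
  have h := congrArg ENNReal.ofReal (sum_sq_norm_signed_sum N c)
  rw [ENNReal.ofReal_sum_of_nonneg fun _ _ ↦ by positivity,
    ENNReal.ofReal_mul (by positivity), ENNReal.ofReal_sum_of_nonneg fun _ _ ↦ by positivity] at h
  simpa [ENNReal.ofReal_pow, ofReal_norm] using h

/-- Flipping the `j`-th sign changes the sum by `2 * c j` up to sign, so one of the two sums has
modulus at least `‖c j‖`. This works for every `r ≥ 0`, including `r < 1`. -/
theorem enorm_rpow_le_sum_signed_sum {N : ℕ} (c : Fin N → ℂ) (j : Fin N) {r : ℝ} (hr : 0 ≤ r) :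
    2 ^ N * ‖c j‖ₑ ^ r ≤ 2 * ∑ ε : Fin N → Bool, ‖∑ k, boolSign (ε k) * c k‖ₑ ^ r := by
  let flip (ε : Fin N → Bool) : Fin N → Bool := Function.update ε j (!ε j)
  have hflip : Function.Involutive flip := by
    intro ε
    simp [flip]
  set S : (Fin N → Bool) → ℂ := fun ε ↦ ∑ k, boolSign (ε k) * c k with hS
  have h1 : ∑ ε, ‖S (flip ε)‖ₑ ^ r = ∑ ε, ‖S ε‖ₑ ^ r :=
    hflip.toPerm.sum_comp (Finset.univ) (fun ε ↦ ‖S ε‖ₑ ^ r) (by simp)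
  have h2 (ε : Fin N → Bool) : ‖c j‖ₑ ^ r ≤ ‖S ε‖ₑ ^ r + ‖S (flip ε)‖ₑ ^ r := by
    have h3 : S ε - S (flip ε) = 2 * (boolSign (ε j) * c j) := by
      rw [hS, ← Finset.sum_sub_distrib, Finset.sum_eq_single j]
      · simp only [flip, Function.update_self, boolSign_not]
        ring
      · intro k _ hk
        simp [flip, Function.update_of_ne hk]
      · simp
    have h4 : 2 * ‖c j‖ ≤ ‖S ε‖ + ‖S (flip ε)‖ := by
      have := norm_sub_le (S ε) (S (flip ε))
      rwa [h3, norm_mul, norm_mul, norm_boolSign, one_mul, Complex.norm_two] at this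
    rcases le_total ‖S ε‖ ‖S (flip ε)‖ with h | h
    · refine le_trans (ENNReal.rpow_le_rpow ?_ hr) le_add_self
      rw [enorm_le_iff_norm_le]
      linarith
    · refine le_trans (ENNReal.rpow_le_rpow ?_ hr) le_self_add
      rw [enorm_le_iff_norm_le]
      linarith
  calc 2 ^ N * ‖c j‖ₑ ^ r = ∑ _ε : Fin N → Bool, ‖c j‖ₑ ^ r := by simp
    _ ≤ ∑ ε, (‖S ε‖ₑ ^ r + ‖S (flip ε)‖ₑ ^ r) := Finset.sum_le_sum fun ε _ ↦ h2 ε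
    _ = 2 * ∑ ε, ‖S ε‖ₑ ^ r := by rw [Finset.sum_add_distrib, h1, two_mul]

/-! ### Lower bound from disjoint balls, upper bound from Hölder -/

section Translates

variable {G : Type*} [NormedAddCommGroup G] [NormedSpace ℝ G] [MeasurableSpace G] [BorelSpace G]
  (μ : Measure G) [μ.IsAddRightInvariant]

/-- The balls are disjoint as `2 ≤ ‖v‖`. On the `k`-th one, the sign average retains the `k`-th term
whatever the others are, so no decay of `W` is needed. -/
theorem card_mul_lintegral_le_sum_signed_translates {W : G → ℂ} (hW : Continuous W) {v : G}
    (hv : 2 ≤ ‖v‖) (N : ℕ) {D : Set G} (hD : ∀ k : Fin N, Metric.ball (-((k : ℝ) • v)) 1 ⊆ D)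
    {r : ℝ} (hr : 0 ≤ r) :
    2 ^ N * (N * ∫⁻ z in Metric.ball 0 1, ‖W z‖ₑ ^ r ∂μ) ≤
      2 * ∑ ε : Fin N → Bool,
        ∫⁻ z in D, ‖∑ k : Fin N, boolSign (ε k) * W (z + (k : ℝ) • v)‖ₑ ^ r ∂μ := by
  have hS (ε : Fin N → Bool) :
      Continuous fun z ↦ ∑ k : Fin N, boolSign (ε k) * W (z + (k : ℝ) • v) := by
    fun_prop
  have hSm (ε : Fin N → Bool) : Measurable fun z ↦
      ‖∑ k : Fin N, boolSign (ε k) * W (z + (k : ℝ) • v)‖ₑ ^ r :=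
    (ENNReal.continuous_rpow_const.comp (hS ε).enorm).measurable
  have hWm : Measurable fun z ↦ ‖W z‖ₑ ^ r :=
    (ENNReal.continuous_rpow_const.comp hW.enorm).measurable
  have hdisj : (↑(Finset.univ : Finset (Fin N)) : Set (Fin N)).PairwiseDisjoint
      fun k : Fin N ↦ Metric.ball (-((k : ℝ) • v)) 1 := by
    intro k _ l _ hkl
    refine Metric.ball_disjoint_ball ?_
    rw [dist_neg_neg, dist_eq_norm, ← sub_smul, norm_smul]
    have h1 : (1 : ℝ) ≤ ‖(k : ℝ) - (l : ℝ)‖ := by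
      have h2 : ((k : ℕ) : ℤ) - ((l : ℕ) : ℤ) ≠ 0 := by
        intro h
        exact hkl (Fin.ext (by omega))
      have h3 := Int.one_le_abs h2
      rw [Real.norm_eq_abs]
      exact_mod_cast h3
    nlinarith [norm_nonneg v]
  have htrans (k : Fin N) : ∫⁻ z in Metric.ball (-((k : ℝ) • v)) 1,
      ‖W (z + (k : ℝ) • v)‖ₑ ^ r ∂μ = ∫⁻ z in Metric.ball 0 1, ‖W z‖ₑ ^ r ∂μ := by
    rw [← (measurePreserving_add_right μ ((k : ℝ) • v)).setLIntegral_comp_preimage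
      Metric.isOpen_ball.measurableSet hWm]
    congr 2
    ext z
    simp [dist_eq_norm]
  calc 2 ^ N * (N * ∫⁻ z in Metric.ball 0 1, ‖W z‖ₑ ^ r ∂μ)
      = ∑ k : Fin N, ∫⁻ z in Metric.ball (-((k : ℝ) • v)) 1,
          2 ^ N * ‖W (z + (k : ℝ) • v)‖ₑ ^ r ∂μ := by
        have h (k : Fin N) : ∫⁻ z in Metric.ball (-((k : ℝ) • v)) 1,
            2 ^ N * ‖W (z + (k : ℝ) • v)‖ₑ ^ r ∂μ =
              2 ^ N * ∫⁻ z in Metric.ball 0 1, ‖W z‖ₑ ^ r ∂μ := by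
          rw [← htrans k]
          exact lintegral_const_mul _ (hWm.comp (measurable_add_const _))
        simp only [h, Finset.sum_const, Finset.card_univ, Fintype.card_fin, nsmul_eq_mul]
        ring
    _ ≤ ∑ k : Fin N, ∫⁻ z in Metric.ball (-((k : ℝ) • v)) 1, 2 * ∑ ε : Fin N → Bool,
          ‖∑ k : Fin N, boolSign (ε k) * W (z + (k : ℝ) • v)‖ₑ ^ r ∂μ :=
        Finset.sum_le_sum fun k _ ↦ lintegral_mono fun z ↦
          enorm_rpow_le_sum_signed_sum (fun k : Fin N ↦ W (z + (k : ℝ) • v)) k hr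
    _ = ∫⁻ z in ⋃ k ∈ Finset.univ, Metric.ball (-(((k : Fin N) : ℝ) • v)) 1,
          2 * ∑ ε : Fin N → Bool,
            ‖∑ k : Fin N, boolSign (ε k) * W (z + (k : ℝ) • v)‖ₑ ^ r ∂μ :=
        (lintegral_biUnion_finset hdisj (fun _ _ ↦ Metric.isOpen_ball.measurableSet) _).symm
    _ ≤ ∫⁻ z in D, 2 * ∑ ε : Fin N → Bool,
            ‖∑ k : Fin N, boolSign (ε k) * W (z + (k : ℝ) • v)‖ₑ ^ r ∂μ :=
        lintegral_mono_set (Set.iUnion₂_subset fun k _ ↦ hD k)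
    _ = _ := by
        rw [lintegral_const_mul _ (Finset.measurable_fun_sum _ fun ε _ ↦ hSm ε),
          lintegral_finsetSum _ fun ε _ ↦ hSm ε]

end Translates

theorem lintegral_ball_enorm_rpow_pos {G : Type*} [PseudoMetricSpace G] [MeasurableSpace G]
    [BorelSpace G] (μ : Measure G) [μ.IsOpenPosMeasure] {W : G → ℂ} (hW : Continuous W) {z : G}
    (hz : W z ≠ 0) {δ : ℝ} (hδ : 0 < δ) {r : ℝ} (hr : 0 < r) :
    0 < ∫⁻ x in Metric.ball z δ, ‖W x‖ₑ ^ r ∂μ := by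
  have hc : Continuous fun x ↦ ‖W x‖ₑ ^ r := ENNReal.continuous_rpow_const.comp hW.enorm
  rw [setLIntegral_pos_iff hc.measurable]
  refine IsOpen.measure_pos μ (hc.isOpen_support.inter Metric.isOpen_ball)
    ⟨z, ?_, Metric.mem_ball_self hδ⟩
  rw [Function.mem_support, Ne, ENNReal.rpow_eq_zero_iff_of_pos hr]
  simpa using hz

/-- Hölder in `x` on `B`, then in `t` on `A`. If an exponent already equals `r`, the measure appears
to the power zero and the set may be infinite, since `⊤ ^ 0 = 1`. -/
theorem setLIntegral_prod_rpow_le_mixedNorm {n : ℕ} {p q r : ℝ≥0∞} (hr : r ≠ 0) (hr' : r ≠ ⊤)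
    (hrp : r ≤ p) (hrq : r ≤ q) {u : ℝ × Space n → ℂ} (hu : Continuous u) (A : Set ℝ)
    (B : Set (Space n)) (hB : volume B ^ (1 / r.toReal - 1 / q.toReal) ≠ ⊤) :
    ∫⁻ z in A ×ˢ B, ‖u z‖ₑ ^ r.toReal ≤
      (volume B ^ (1 / r.toReal - 1 / q.toReal) * mixedNorm p q (fun t x ↦ u (t, x)) *
        volume A ^ (1 / r.toReal - 1 / p.toReal)) ^ r.toReal := by
  have hr0 : 0 < r.toReal := ENNReal.toReal_pos hr hr'
  have hm : Measurable fun z ↦ ‖u z‖ₑ ^ r.toReal :=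
    (ENNReal.continuous_rpow_const.comp hu.enorm).measurable
  have hut (t : ℝ) : Continuous fun x ↦ u (t, x) := hu.comp (Continuous.prodMk_right t)
  have hnorm (t : ℝ) : eLpNorm (fun x ↦ u (t, x)) r (volume.restrict B) =
      (∫⁻ x in B, ‖u (t, x)‖ₑ ^ r.toReal) ^ (1 / r.toReal) :=
    eLpNorm_eq_lintegral_rpow_enorm_toReal hr hr'
  have hslice : Measurable fun t ↦ eLpNorm (fun x ↦ u (t, x)) r (volume.restrict B) := by
    simp only [hnorm]
    exact (hm.lintegral_prod_right' (ν := volume.restrict B)).pow_const _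
  have h1 : ∫⁻ z in A ×ˢ B, ‖u z‖ₑ ^ r.toReal =
      (eLpNorm (fun t ↦ eLpNorm (fun x ↦ u (t, x)) r (volume.restrict B)) r
        (volume.restrict A)) ^ r.toReal := by
    rw [Measure.volume_eq_prod, setLIntegral_prod _ hm.aemeasurable,
      eLpNorm_eq_lintegral_rpow_enorm_toReal hr hr', ← ENNReal.rpow_mul,
      one_div_mul_cancel hr0.ne', ENNReal.rpow_one]
    refine lintegral_congr fun t ↦ ?_
    rw [enorm_eq_self, hnorm, ← ENNReal.rpow_mul, one_div_mul_cancel hr0.ne', ENNReal.rpow_one]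
  rw [h1]
  refine ENNReal.rpow_le_rpow ?_ hr0.le
  refine (eLpNorm_le_eLpNorm_mul_rpow_measure_univ hrp hslice.aestronglyMeasurable).trans ?_
  rw [Measure.restrict_apply_univ]
  refine mul_le_mul_left ?_ _
  refine (eLpNorm_mono_measure _ Measure.restrict_le_self).trans ?_
  rw [← ENNReal.coe_toNNReal hB]
  refine eLpNorm_le_mul_eLpNorm_of_ae_le_mul' (.of_forall fun t ↦ ?_) p
  rw [enorm_eq_self, enorm_eq_self, ENNReal.coe_toNNReal hB]
  have h2 := eLpNorm_le_eLpNorm_mul_rpow_measure_univ (μ := volume.restrict B) hrq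
    (hut t).aestronglyMeasurable
  rw [Measure.restrict_apply_univ, mul_comm] at h2
  exact h2.trans (mul_le_mul_right (eLpNorm_mono_measure _ Measure.restrict_le_self) _)

theorem not_forall_natCast_mul_le_mul_rpow {m B : ℝ≥0∞} (hm : m ≠ 0) (hB : B ≠ ⊤) {θ : ℝ}
    (hθ0 : 0 ≤ θ) (hθ : θ < 1) : ¬ ∀ N : ℕ, (N : ℝ≥0∞) * m ≤ B * (N : ℝ≥0∞) ^ θ := by
  intro h
  have hmt : m ≠ ⊤ := by
    have h1 := h 1
    rw [Nat.cast_one, one_mul, ENNReal.one_rpow, mul_one] at h1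
    exact ne_top_of_le_ne_top hB h1
  have hreal (N : ℕ) : (N : ℝ) * m.toReal ≤ B.toReal * (N : ℝ) ^ θ := by
    have h1 := ENNReal.toReal_mono (ENNReal.mul_ne_top hB
      (ENNReal.rpow_ne_top_of_nonneg hθ0 (ENNReal.natCast_ne_top N))) (h N)
    simpa [ENNReal.toReal_mul, ← ENNReal.toReal_rpow] using h1
  have hm0 : 0 < m.toReal := ENNReal.toReal_pos hm hmt
  obtain ⟨N, hN, hN1⟩ := (((tendsto_rpow_atTop (sub_pos.2 hθ)).comp
    (tendsto_natCast_atTop_atTop (R := ℝ))).eventually_gt_atTop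
      (B.toReal / m.toReal) |>.and (Filter.eventually_ge_atTop 1)).exists
  have hN0 : (0 : ℝ) < N := by exact_mod_cast hN1
  rw [Function.comp_apply, div_lt_iff₀ hm0] at hN
  have h2 : (N : ℝ) = (N : ℝ) ^ (1 - θ) * (N : ℝ) ^ θ := by
    rw [← Real.rpow_add hN0, sub_add_cancel, Real.rpow_one]
  have h3 := hreal N
  have h4 : 0 < (N : ℝ) ^ θ := Real.rpow_pos_of_pos hN0 _
  nlinarith [mul_lt_mul_of_pos_right hN h4]

/-! ### Sobolev norms of signed sums and the contradiction -/

/-- The Sobolev norm of the function with Fourier transform `exp (-‖ζ‖²)`. -/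
def gaussianSobolevNorm (n : ℕ) (s : ℝ) : ℝ≥0∞ :=
  eLpNorm (fun ζ : Space2 n ↦ (((1 + (2 * Real.pi * ‖ζ‖) ^ 2) ^ (s / 2) : ℝ) : ℂ) *
    gaussian 1 0 ζ) 2 volume

/-- Pointwise in frequency the terms differ only by phases, so sign orthogonality applies under the
integral. -/
theorem sum_sq_sobolevNorm_signed_sum {n N : ℕ} (s : ℝ) (τ : Fin N → ℝ) (a : Fin N → Space2 n)
    (Λ : (Fin N → Bool) → Space2 n → ℂ)
    (hΛ : ∀ ε ζ, 𝓕 (Λ ε) ζ = ∑ k, boolSign (ε k) * gaussian (width (τ k)) (a k) ζ) :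
    ∑ ε, sobolevNorm s (Λ ε) ^ (2 : ℝ) = 2 ^ N * (N * gaussianSobolevNorm n s ^ (2 : ℝ)) := by
  have hsq (f : Space2 n → ℂ) : eLpNorm f 2 volume ^ (2 : ℝ) = ∫⁻ ζ, ‖f ζ‖ₑ ^ 2 := by
    have := eLpNorm_nnreal_pow_eq_lintegral (f := f) (μ := volume) (p := 2) two_ne_zero
    simpa using this
  have hgauss (k : Fin N) (ζ : Space2 n) :
      ‖gaussian (width (τ k)) (a k) ζ‖ₑ = ‖gaussian 1 0 ζ‖ₑ := by
    rw [enorm_eq_iff_norm_eq, norm_gaussian, norm_gaussian, width_re, Complex.one_re]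
  have hw : Continuous fun ζ : Space2 n ↦
      (((1 + (2 * Real.pi * ‖ζ‖) ^ 2) ^ (s / 2) : ℝ) : ℂ) := by
    refine Complex.continuous_ofReal.comp (Continuous.rpow_const (by fun_prop) fun ζ ↦ .inl ?_)
    positivity
  have hmeas (ε : Fin N → Bool) : Measurable fun ζ : Space2 n ↦
      ‖(((1 + (2 * Real.pi * ‖ζ‖) ^ 2) ^ (s / 2) : ℝ) : ℂ) *
        ∑ k, boolSign (ε k) * gaussian (width (τ k)) (a k) ζ‖ₑ ^ 2 := by
    refine Continuous.measurable ?_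
    refine (ENNReal.continuous_pow 2).comp (Continuous.enorm (hw.mul ?_))
    exact continuous_finsetSum _ fun k _ ↦ continuous_const.mul (continuous_gaussian _ _)
  simp only [sobolevNorm, hΛ, hsq, gaussianSobolevNorm]
  rw [← lintegral_finsetSum _ fun ε _ ↦ hmeas ε]
  have hmul (x y : ℂ) : ‖x * y‖ₑ ^ 2 = ‖x‖ₑ ^ 2 * ‖y‖ₑ ^ 2 := by rw [enorm_mul, mul_pow]
  simp only [hmul, ← Finset.mul_sum, sum_sq_enorm_signed_sum, hgauss,
    Finset.sum_const, Finset.card_univ, Fintype.card_fin, nsmul_eq_mul]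
  have hm1 : Measurable fun ζ : Space2 n ↦
      ‖(((1 + (2 * Real.pi * ‖ζ‖) ^ 2) ^ (s / 2) : ℝ) : ℂ)‖ₑ ^ 2 * ‖gaussian 1 0 ζ‖ₑ ^ 2 :=
    (((ENNReal.continuous_pow 2).comp hw.enorm).measurable).mul
      ((ENNReal.continuous_pow 2).comp (continuous_gaussian 1 (0 : Space2 n)).enorm).measurable
  rw [← mul_assoc, ← lintegral_const_mul _ hm1]
  refine lintegral_congr fun ζ ↦ ?_
  ring

/-- The power mean inequality over the `2 ^ N` sign choices. -/
theorem sum_rpow_le_of_sum_sq_eq {N : ℕ} (H : (Fin N → Bool) → ℝ≥0∞) {Q : ℝ≥0∞}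
    (hH : ∑ ε, H ε ^ (2 : ℝ) = 2 ^ N * Q) {r : ℝ} (hr : 0 < r) (hr2 : r ≤ 2) :
    ∑ ε, H ε ^ r ≤ 2 ^ N * Q ^ (r / 2) := by
  have h1 := ENNReal.rpow_sum_le_const_mul_sum_rpow Finset.univ (fun ε ↦ H ε ^ r)
    (p := 2 / r) ((one_le_div hr).2 hr2)
  have hcard : ((Finset.univ : Finset (Fin N → Bool)).card : ℝ≥0∞) = 2 ^ N := by simp
  have h2 : (2 ^ N : ℝ≥0∞) ≠ 0 := by simp
  have h2' : (2 ^ N : ℝ≥0∞) ≠ ⊤ := by finiteness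
  simp only [← ENNReal.rpow_mul, mul_div_cancel₀ (2 : ℝ) hr.ne'] at h1
  rw [hcard, hH, ← mul_assoc] at h1
  nth_rewrite 2 [← ENNReal.rpow_one (2 ^ N : ℝ≥0∞)] at h1
  rw [← ENNReal.rpow_add _ _ h2 h2', sub_add_cancel] at h1
  have h3 := ENNReal.rpow_le_rpow h1 (by positivity : 0 ≤ r / 2)
  have h4 : 2 / r * (r / 2) = 1 := by field_simp
  rwa [← ENNReal.rpow_mul, ENNReal.mul_rpow_of_nonneg _ _ (by positivity), ← ENNReal.rpow_mul,
    h4, ENNReal.rpow_one, ENNReal.rpow_one] at h3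

theorem not_mixedNorm_le_of_translates {n : ℕ} (hn : 1 ≤ n) {p q r : ℝ≥0∞} (hr : r ≠ 0)
    (hr2 : r < 2) (hrp : r ≤ p) (hrq : r ≤ q) {α s : ℝ} (hα : 0 ≤ α) {A : Set ℝ}
    {B : Set (Space n)} (hA : volume A ^ (1 / r.toReal - 1 / p.toReal) ≠ ⊤)
    (hB : volume B ^ (1 / r.toReal - 1 / q.toReal) ≠ ⊤) {v : ℝ × Space n} (hv : 2 ≤ ‖v‖)
    (hAB : ∀ k : ℕ, Metric.ball (-((k : ℝ) • v)) 1 ⊆ A ×ˢ B) (C : ℝ≥0) :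
    ¬ ∀ Λ₀ : 𝓢(Space2 n, ℂ),
      mixedNorm p q (fun t ↦ fracDeriv α (diagonal (evolution (⇑Λ₀) t))) ≤
        C * sobolevNorm s (⇑Λ₀) := by
  intro hest
  have hr' : r ≠ ⊤ := (hr2.trans_le le_top).ne
  have hρ : 0 < r.toReal := ENNReal.toReal_pos hr hr'
  have hρ2 : r.toReal < 2 := by
    have := ENNReal.toReal_strict_mono ENNReal.ofNat_ne_top hr2
    simpa using this
  set ρ := r.toReal
  set W : ℝ × Space n → ℂ := fun z ↦ profile α z.1 z.2
  have hW : Continuous W := continuous_profile hα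
  set KA := volume A ^ (1 / ρ - 1 / p.toReal)
  set KB := volume B ^ (1 / ρ - 1 / q.toReal)
  set M := gaussianSobolevNorm n s
  have hM : M ≠ ⊤ := eLpNorm_sobolev_gaussian_ne_top s
  have hW0 : W 0 ≠ 0 := profile_zero_ne_zero hn hα
  have hm := (lintegral_ball_enorm_rpow_pos volume hW hW0 one_pos hρ).ne'
  refine not_forall_natCast_mul_le_mul_rpow
    (B := 2 * ((KB * C * KA) ^ ρ * (M ^ (2 : ℝ)) ^ (ρ / 2))) (θ := ρ / 2)
    hm ?_ (by positivity) (by linarith) fun N ↦ ?_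
  · finiteness
  choose Λ hΛ hΛ' using fun ε : Fin N → Bool ↦ exists_superposition hα Finset.univ
    (fun k ↦ boolSign (ε k)) (fun k ↦ (k : ℝ) * v.1) (fun k ↦ (k : ℝ) • v.2)
  have hupper (ε : Fin N → Bool) :
      ∫⁻ z in A ×ˢ B, ‖∑ k : Fin N, boolSign (ε k) * W (z + (k : ℝ) • v)‖ₑ ^ ρ ≤
        (KB * C * KA) ^ ρ * sobolevNorm s (⇑(Λ ε)) ^ ρ := by
    refine (setLIntegral_prod_rpow_le_mixedNorm (p := p) (q := q) hr hr' hrp hrq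
      (by fun_prop) A B hB).trans ?_
    rw [← ENNReal.mul_rpow_of_nonneg _ _ hρ.le]
    refine ENNReal.rpow_le_rpow ?_ hρ.le
    have h1 : (fun t x ↦ ∑ k : Fin N, boolSign (ε k) * W ((t, x) + (k : ℝ) • v)) =
        fun t ↦ fracDeriv α (diagonal (evolution (⇑(Λ ε)) t)) := by
      ext t x
      simp only [hΛ', W, Prod.fst_add, Prod.snd_add, Prod.smul_fst, Prod.smul_snd, smul_eq_mul]
    rw [h1]
    calc KB * mixedNorm p q (fun t ↦ fracDeriv α (diagonal (evolution (⇑(Λ ε)) t))) * KA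
        ≤ KB * (C * sobolevNorm s (⇑(Λ ε))) * KA := by
          gcongr
          exact hest _
      _ = _ := by ring
  have hsum := sum_rpow_le_of_sum_sq_eq _
    (sum_sq_sobolevNorm_signed_sum s _ _ (fun ε ↦ ⇑(Λ ε)) hΛ) hρ hρ2.le
  have : (volume : Measure (ℝ × Space n)).IsAddRightInvariant :=
    inferInstanceAs ((volume : Measure ℝ).prod (volume : Measure (Space n))).IsAddRightInvariant
  have hlower := card_mul_lintegral_le_sum_signed_translates volume hW hv N
    (fun k ↦ hAB k) hρ.le
  -- Both bounds carry the number `2 ^ N` of sign choices, which cancels.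
  refine (ENNReal.mul_le_mul_iff_right (a := 2 ^ N) (by simp) (by finiteness)).1 ?_
  calc _ ≤ _ := hlower
    _ ≤ 2 * ∑ ε, (KB * C * KA) ^ ρ * sobolevNorm s (⇑(Λ ε)) ^ ρ := by
        gcongr with ε
        exact hupper ε
    _ ≤ 2 * ((KB * C * KA) ^ ρ * (2 ^ N * (N * M ^ (2 : ℝ)) ^ (ρ / 2))) := by
        rw [← Finset.mul_sum]
        gcongr
    _ = _ := by
        rw [ENNReal.mul_rpow_of_nonneg _ _ (by positivity : 0 ≤ ρ / 2)]
        ring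

theorem rpow_volume_ball_ne_top {V : Type*} [NormedAddCommGroup V] [InnerProductSpace ℝ V]
    [FiniteDimensional ℝ V] [MeasurableSpace V] [BorelSpace V] {p r : ℝ≥0∞} (hr : r ≠ 0)
    (hr' : r ≠ ⊤) (hrp : r ≤ p) (δ : ℝ) :
    volume (Metric.ball (0 : V) δ) ^ (1 / r.toReal - 1 / p.toReal) ≠ ⊤ := by
  refine ENNReal.rpow_ne_top_of_nonneg (sub_nonneg.2 ?_) measure_ball_lt_top.ne
  -- For `p = ⊤` the conventions `⊤.toReal = 0` and `1 / 0 = 0` give the right exponent.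
  by_cases hp : p = ⊤
  · simp [hp]
  · exact one_div_le_one_div_of_le (ENNReal.toReal_pos hr hr') (ENNReal.toReal_mono hp hrp)

end Collapsing

end

theorem theorem1 (n : ℕ) (hn : 1 ≤ n) (p q : ℝ≥0∞) (hp : 0 < p) (hq : 0 < q)
    (α s : ℝ) (hα : 0 ≤ α) (hs : 0 ≤ s)
    (hest : ∃ C : ℝ≥0, ∀ Λ₀ : 𝓢(Collapsing.Space2 n, ℂ),
      Collapsing.mixedNorm p q (fun t ↦
          Collapsing.fracDeriv α (Collapsing.diagonal (Collapsing.evolution (⇑Λ₀) t)))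
        ≤ C * Collapsing.sobolevNorm s (⇑Λ₀)) :
    2 ≤ p ∧ 2 ≤ q := by
  obtain ⟨C, hC⟩ := hest
  have key : 2 ≤ min p q := by
    by_contra! h
    rcases le_total p q with hpq | hpq
    · rw [min_eq_left hpq] at h
      have hp' : p ≠ ⊤ := (h.trans_le le_top).ne
      -- Here `r = p`: translate in time, keeping `x` in the unit ball.
      refine Collapsing.not_mixedNorm_le_of_translates hn hp.ne' h le_rfl hpq hα
        (A := Set.univ) (B := Metric.ball 0 1) (v := (2, 0)) (by simp)
        (Collapsing.rpow_volume_ball_ne_top hp.ne' hp' hpq 1) (by simp) (fun k ↦ ?_) C hC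
      rintro ⟨t, x⟩ hz
      rw [Metric.mem_ball, Prod.dist_eq, max_lt_iff] at hz
      exact ⟨trivial, by simpa using hz.2⟩
    · rw [min_eq_right hpq] at h
      have hq' : q ≠ ⊤ := (h.trans_le le_top).ne
      -- Here `r = q`: translate in space, keeping `t` in the unit ball.
      refine Collapsing.not_mixedNorm_le_of_translates hn hq.ne' h hpq le_rfl hα
        (A := Metric.ball 0 1) (B := Set.univ)
        (v := (0, EuclideanSpace.single ⟨0, hn⟩ 2))
        (Collapsing.rpow_volume_ball_ne_top hq.ne' hq' hpq 1) (by simp) (by simp)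
        (fun k ↦ ?_) C hC
      rintro ⟨t, x⟩ hz
      rw [Metric.mem_ball, Prod.dist_eq, max_lt_iff] at hz
      exact ⟨by simpa using hz.1, trivial⟩
  exact le_min_iff.1 key
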